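/- Let $\Gamma$ be a finite weighted digraph without loops, with strictly positive arc weights $w_{ij}$ ($w_{ij}=0$ iff there is no arc from $i$ to $j$). Its Laplacian matrix is $L=(\ell_{ij})$ with $\ell_{ij}=-w_{ij}$ for $j\neq i$ and $\ell_{ii}=\sum_{k\neq i}w_{ik}$. A converging tree is a weakly connected digraph in which one vertex, the root, has outdegree $0$ and all other vertices have outdegree $1$; an in-forest of $\Gamma$ is a spanning subgraph of $\Gamma$ all of whose weak components are converging trees. The weight of a subgraph is the product of the weights of its arcs ($1$ if there are none), and the weight of a set of subgraphs is the sum of their weights ($0$ for the empty set). For $k=0,1,\dots$ let $\sigma_k$ be the total weight of the in-forests of $\Gamma$ with $k$ arcs, and let $Q_k$ be the matrix whose $(i,j)$ entry is the total weight of the in-forests of $\Gamma$ with $k$ arcs in which $i$ belongs to a tree with root $j$. Put $\alpha_0=1$ and, for $k\ge 1$, $$\alpha_k=\sum_{(p_1,\dots,p_k):\ \sum_{i=1}^k ip_i=k}(-1)^{\sum_{i=1}^k p_i}\,\frac{\bigl(\sum_{i=1}^k p_i\bigr)!}{\prod_{i=1}^k p_i!}\,\prod_{i=1}^k\sigma_i^{p_i},$$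 where the $p_i$ are nonnegative integers. Then for every $m=0,1,2,\dots$, $$(-L)^m=\sum_{k=0}^m\alpha_kQ_{m-k}.$$ In particular, the coefficients $\alpha_k$ do not depend on $m$. -/

import Mathlib

open scoped Nat

noncomputable section

/-- A weighted digraph without loops on the vertex set `V`, given by its matrix of arc weights:
`W i j > 0` is the weight of the arc from `i` to `j`, and `W i j = 0` iff there is no such arc. -/
structure WeightedDigraph (V : Type*) where
  W : Matrix V V ℝ
  nonneg : ∀ i j, 0 ≤ W i j
  loopless : ∀ i, W i i = 0

/-- The outdegree of the vertex `v` in the digraph with arc set `F`. -/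
def outdegree {V : Type*} [DecidableEq V] (F : Finset (V × V)) (v : V) : ℕ :=
  (F.filter fun e => e.1 = v).card

/-- The undirected graph on `V` corresponding to the digraph with arc set `F`. Its connected
components are the weak components of this digraph. -/
def underlyingGraph {V : Type*} (F : Finset (V × V)) : SimpleGraph V :=
  SimpleGraph.fromRel fun i j => (i, j) ∈ F

/-- The weak component `c` of the digraph `(V, F)` is a converging tree with root `r`: the vertex
`r` of `c` has outdegree zero, the remaining vertices of `c` have outdegree one. (A weak component
is weakly connected, and every arc that starts in `c` lies in `c`.) -/
def ConvergesTo {V : Type*} [DecidableEq V] (F : Finset (V × V))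
    (c : (underlyingGraph F).ConnectedComponent) (r : V) : Prop :=
  r ∈ c.supp ∧ outdegree F r = 0 ∧ ∀ v ∈ c.supp, v ≠ r → outdegree F v = 1

/-- The digraph `(V, F)` is a converging forest: all its weak components are converging trees. -/
def IsConvergingForest {V : Type*} [DecidableEq V] (F : Finset (V × V)) : Prop :=
  ∀ c : (underlyingGraph F).ConnectedComponent, ∃ r, ConvergesTo F c r

namespace WeightedDigraph

variable {V : Type*} [Fintype V] [DecidableEq V] (Γ : WeightedDigraph V)

/-- The set of arcs. -/
def arcs : Finset (V × V) :=
  open scoped Classical in Finset.univ.filter fun e => 0 < Γ.W e.1 e.2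

/-- The weight of the subgraph with arc set `F`: the product of the weights of its arcs. -/
def subgraphWeight (F : Finset (V × V)) : ℝ :=
  ∏ e ∈ F, Γ.W e.1 e.2

/-- The total weight of a set of spanning subgraphs, each given by its arc set. -/
def setWeight (𝒢 : Finset (Finset (V × V))) : ℝ :=
  ∑ F ∈ 𝒢, Γ.subgraphWeight F

/-- The set of in-forests (spanning converging forests) of `Γ` with `k` arcs; a spanning subgraph
is given by its arc set. -/
def inForests (k : ℕ) : Finset (Finset (V × V)) :=
  open scoped Classical in (Γ.arcs.powersetCard k).filter IsConvergingForest

/-- The set of in-forests with `k` arcs in which `i` belongs to a tree converging to `j`. -/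
def inForestsTo (k : ℕ) (i j : V) : Finset (Finset (V × V)) :=
  open scoped Classical in
  (Γ.inForests k).filter fun F => ConvergesTo F ((underlyingGraph F).connectedComponentMk i) j

/-- `σ_k`, the total weight of in-forests with `k` arcs. -/
def sigma (k : ℕ) : ℝ :=
  Γ.setWeight (Γ.inForests k)

/-- `Q_k`, the matrix of in-forests with `k` arcs. -/
def Q (k : ℕ) : Matrix V V ℝ :=
  Matrix.of fun i j => Γ.setWeight (Γ.inForestsTo k i j)

/-- The (row) Laplacian matrix. -/
def laplacian : Matrix V V ℝ :=
  Matrix.of fun i j => if i = j then ∑ k ∈ Finset.univ.erase i, Γ.W i k else -Γ.W i j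

end WeightedDigraph

/-- The tuples `(p_1, …, p_k)` of nonnegative integers with `∑ i * p_i = k`. The component `p_i` is
`p ⟨i - 1, _⟩`; the bound `p_i ≤ k` follows from the equation, see `mem_partitionTuples`. -/
def partitionTuples (k : ℕ) : Finset (Fin k → ℕ) :=
  (Fintype.piFinset fun _ : Fin k => Finset.range (k + 1)).filter
    fun p => ∑ i : Fin k, ((i : ℕ) + 1) * p i = k

theorem mem_partitionTuples (k : ℕ) (p : Fin k → ℕ) :
    p ∈ partitionTuples k ↔ ∑ i : Fin k, ((i : ℕ) + 1) * p i = k := by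
  unfold partitionTuples
  rw [Finset.mem_filter, Fintype.mem_piFinset]
  refine ⟨fun h => h.2, fun h => ⟨fun i => ?_, h⟩⟩
  have h1 : ((i : ℕ) + 1) * p i ≤ ∑ i : Fin k, ((i : ℕ) + 1) * p i :=
    Finset.single_le_sum (f := fun i : Fin k => ((i : ℕ) + 1) * p i)
      (fun _ _ => Nat.zero_le _) (Finset.mem_univ i)
  rw [Finset.mem_range]
  nlinarith [Nat.zero_le ((i : ℕ) * p i)]

/-- The coefficients `α_k`: `α_0 = 1`, and for `k ≥ 1` the sum over all `(p_1, …, p_k)` with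
`∑ i * p_i = k` of `(-1) ^ (∑ p_i) * (∑ p_i)! / ∏ p_i ! * ∏ σ_i ^ p_i`. -/
def WeightedDigraph.alpha {V : Type*} [Fintype V] [DecidableEq V] (Γ : WeightedDigraph V)
    (k : ℕ) : ℝ :=
  if k = 0 then 1
  else ∑ p ∈ partitionTuples k,
    (-1 : ℝ) ^ (∑ i, p i) * (((∑ i, p i)! : ℝ) / ((∏ i, (p i)! : ℕ) : ℝ)) *
      ∏ i : Fin k, Γ.sigma ((i : ℕ) + 1) ^ p i

end

/-! The heart of the matter is the recurrence `Q_succ`: Q_{k+1} = σ_{k+1} I − L Q_k. Cutting the arc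
that leaves `i` turns a forest where `i` is not a root into one where it is, and joining `i` to
another tree undoes this. On the diagonal this counts the forests in which `i` is not a root
(`sigma_succ_sub_Q`); off the diagonal one also redirects the arc leaving `i`
(`sum_weight_mul_Q_of_ne`).

By the geometric series and the multinomial theorem, α_k is the k-th coefficient of 1 / ∑ σ_i X^i
(`alpha_eq_coeff`), so ∑ α_k σ_{n−k} = 0 for n ≥ 1. Multiplying the formula for (−L)^m by −L and
applying the recurrence, the multiples of I add up to exactly the new term α_{m+1} Q_0. -/

set_option linter.unusedSectionVars false

/-! ### Converging forests described by directed walks to sinks -/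

section Reachability

variable {V : Type*} {F G : Finset (V × V)} {a b i j l r s v : V}

/-- `v` has no outgoing arc. -/
def IsSink (F : Finset (V × V)) (v : V) : Prop := ∀ b, (v, b) ∉ F

/-- The sink `r` can be reached from `v` along the arcs of `F`. -/
def LeadsTo (F : Finset (V × V)) (v r : V) : Prop :=
  Relation.ReflTransGen (fun a b => (a, b) ∈ F) v r ∧ IsSink F r

/-- No two arcs have the same tail. -/
def IsFunctional (F : Finset (V × V)) : Prop := ∀ v a b, (v, a) ∈ F → (v, b) ∈ F → a = b

/-- Every vertex leads to a sink, along arcs that are determined by their tails. -/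
def IsFunctionalForest (F : Finset (V × V)) : Prop :=
  IsFunctional F ∧ ∀ v, ∃ r, LeadsTo F v r

theorem IsSink.leadsTo (h : IsSink F v) : LeadsTo F v v := ⟨.refl, h⟩

theorem IsSink.leadsTo_iff (h : IsSink F v) : LeadsTo F v r ↔ v = r := by
  refine ⟨fun ⟨h1, _⟩ => ?_, fun e => e ▸ h.leadsTo⟩
  rcases h1.cases_head with h1 | ⟨c, hc, _⟩
  · exact h1
  · exact absurd hc (h c)

theorem IsFunctional.leadsTo_iff_of_mem (hF : IsFunctional F) (h : (a, b) ∈ F) :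
    LeadsTo F a r ↔ LeadsTo F b r := by
  refine ⟨fun ⟨h1, h2⟩ => ⟨?_, h2⟩, fun ⟨h1, h2⟩ => ⟨.head h h1, h2⟩⟩
  rcases h1.cases_head with rfl | ⟨c, hc, h3⟩
  · exact absurd h (h2 b)
  · rwa [hF a b c h hc]

theorem IsFunctional.leadsTo_unique (hF : IsFunctional F) (h : LeadsTo F v r)
    (h' : LeadsTo F v s) : r = s := by
  obtain ⟨h1, h2⟩ := h
  induction h1 using Relation.ReflTransGen.head_induction_on with
  | refl => exact (h2.leadsTo_iff).1 h'
  | head hab _ ih => exact ih ((hF.leadsTo_iff_of_mem hab).1 h')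

/-- Crossing an arc in either direction preserves the sink reached, so it is constant on weak
components. -/
theorem IsFunctional.leadsTo_iff_of_reachable (hF : IsFunctional F)
    (h : (underlyingGraph F).Reachable a b) : LeadsTo F a r ↔ LeadsTo F b r := by
  obtain ⟨p⟩ := h
  induction p with
  | nil => rfl
  | cons hadj _ ih =>
    rw [← ih]
    rcases ((SimpleGraph.fromRel_adj _ _ _).1 hadj).2 with h | h
    · exact hF.leadsTo_iff_of_mem h
    · exact (hF.leadsTo_iff_of_mem h).symm

theorem LeadsTo.reachable (h : LeadsTo F a r) : (underlyingGraph F).Reachable a r := by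
  obtain ⟨h1, h2⟩ := h
  clear h2
  induction h1 with
  | refl => rfl
  | @tail x y _ hxy ih =>
    -- `SimpleGraph.fromRel` drops loops, so a loop has to be treated as a trivial step.
    by_cases e : x = y
    · exact e ▸ ih
    · exact ih.trans
        (SimpleGraph.Adj.reachable ((SimpleGraph.fromRel_adj _ _ _).2 ⟨e, Or.inl hxy⟩))

variable [DecidableEq V]

theorem outdegree_eq_zero_iff : outdegree F v = 0 ↔ IsSink F v := by
  rw [outdegree, Finset.card_eq_zero, Finset.filter_eq_empty_iff]
  exact ⟨fun h b hb => h hb rfl, fun h e he h1 => h e.2 (by rw [← h1]; exact he)⟩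

theorem outdegree_le_one_iff : outdegree F v ≤ 1 ↔ ∀ a b, (v, a) ∈ F → (v, b) ∈ F → a = b := by
  rw [outdegree, Finset.card_le_one]
  constructor
  · intro h a b ha hb
    exact congrArg Prod.snd
      (h (v, a) (Finset.mem_filter.2 ⟨ha, rfl⟩) (v, b) (Finset.mem_filter.2 ⟨hb, rfl⟩))
  · rintro h ⟨x, a⟩ ha ⟨y, b⟩ hb
    obtain ⟨ha', hx : x = v⟩ := Finset.mem_filter.1 ha
    obtain ⟨hb', hy : y = v⟩ := Finset.mem_filter.1 hb
    rw [hx] at ha' ⊢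
    rw [hy] at hb' ⊢
    rw [h a b ha' hb']

theorem IsConvergingForest.isFunctional (h : IsConvergingForest F) : IsFunctional F := by
  intro v
  rw [← outdegree_le_one_iff]
  obtain ⟨r, _, h0, h1⟩ := h ((underlyingGraph F).connectedComponentMk v)
  by_cases e : v = r
  · rw [e, h0]; exact zero_le_one
  · exact (h1 v rfl e).le

theorem IsFunctional.leadsTo_of_convergesTo (hF : IsFunctional F)
    (h : ConvergesTo F ((underlyingGraph F).connectedComponentMk v) r) : LeadsTo F v r := by
  have hr : IsSink F r := outdegree_eq_zero_iff.1 h.2.1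
  exact (hF.leadsTo_iff_of_reachable (SimpleGraph.ConnectedComponent.exact h.1)).1 hr.leadsTo

theorem IsFunctional.convergesTo_iff (hF : IsFunctional F) :
    ConvergesTo F ((underlyingGraph F).connectedComponentMk v) r ↔ LeadsTo F v r := by
  refine ⟨hF.leadsTo_of_convergesTo, fun h => ⟨?_, outdegree_eq_zero_iff.2 h.2, ?_⟩⟩
  · exact SimpleGraph.ConnectedComponent.sound h.reachable.symm
  · intro u hu hur
    have h2 : LeadsTo F u r :=
      (hF.leadsTo_iff_of_reachable (SimpleGraph.ConnectedComponent.exact hu)).2 h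
    have h3 : outdegree F u ≠ 0 := fun h0 =>
      hur ((outdegree_eq_zero_iff.1 h0).leadsTo_iff.1 h2)
    have h4 : outdegree F u ≤ 1 := outdegree_le_one_iff.2 (hF u)
    omega

theorem isConvergingForest_iff : IsConvergingForest F ↔ IsFunctionalForest F := by
  constructor
  · intro h
    refine ⟨h.isFunctional, fun v => ?_⟩
    obtain ⟨r, hr⟩ := h ((underlyingGraph F).connectedComponentMk v)
    exact ⟨r, h.isFunctional.leadsTo_of_convergesTo hr⟩
  · intro h c
    induction c using SimpleGraph.ConnectedComponent.ind with
    | h v =>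
      obtain ⟨r, hr⟩ := h.2 v
      exact ⟨r, h.1.convergesTo_iff.2 hr⟩

theorem isFunctionalForest_empty : IsFunctionalForest (∅ : Finset (V × V)) :=
  ⟨fun _ _ _ h => absurd h (Finset.notMem_empty _),
    fun v => ⟨v, IsSink.leadsTo fun _ => Finset.notMem_empty _⟩⟩

theorem mem_insert_arc : (a, b) ∈ insert (i, l) F ↔ (a = i ∧ b = l) ∨ (a, b) ∈ F := by
  rw [Finset.mem_insert, Prod.mk.injEq]

theorem IsFunctional.insert_arc (hF : IsFunctional F) (hi : IsSink F i) :
    IsFunctional (insert (i, l) F) := by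
  intro v a b ha hb
  rw [mem_insert_arc] at ha hb
  rcases ha with ⟨rfl, rfl⟩ | ha <;> rcases hb with ⟨hv, rfl⟩ | hb
  · rfl
  · exact absurd hb (hi b)
  · exact absurd (hv ▸ ha) (hi a)
  · exact hF v a b ha hb

theorem IsSink.insert_arc (h : IsSink F r) (hr : r ≠ i) : IsSink (insert (i, l) F) r := by
  intro b hb
  rcases mem_insert_arc.1 hb with ⟨h1, _⟩ | h1
  · exact hr h1
  · exact h b h1

theorem not_isSink_insert : ¬ IsSink (insert (i, l) F) i :=
  fun h => h l (Finset.mem_insert_self _ _)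

theorem LeadsTo.insert_arc (h : LeadsTo F v r) (hr : r ≠ i) : LeadsTo (insert (i, l) F) v r :=
  ⟨Relation.ReflTransGen.mono (fun _ _ => Finset.mem_insert_of_mem) _ _ h.1, h.2.insert_arc hr⟩

theorem LeadsTo.insert_trans (h : LeadsTo F v i) (hl : LeadsTo F l r) (hr : r ≠ i) :
    LeadsTo (insert (i, l) F) v r :=
  ⟨(Relation.ReflTransGen.mono (fun _ _ => Finset.mem_insert_of_mem) _ _ h.1).trans
    (.head (Finset.mem_insert_self _ _) (hl.insert_arc hr).1), hl.2.insert_arc hr⟩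

theorem IsFunctionalForest.insert_arc (hF : IsFunctionalForest F) (hi : IsSink F i)
    (hl : ¬ LeadsTo F l i) : IsFunctionalForest (insert (i, l) F) := by
  refine ⟨hF.1.insert_arc hi, fun v => ?_⟩
  obtain ⟨s, hs⟩ := hF.2 l
  have hsi : s ≠ i := fun e => hl (e ▸ hs)
  obtain ⟨r, hr⟩ := hF.2 v
  by_cases e : r = i
  · exact ⟨s, (e ▸ hr).insert_trans hs hsi⟩
  · exact ⟨r, hr.insert_arc e⟩

/-- The new arc hangs the tree rooted at `i` onto the tree of `l`: walks that ended at `i` now go on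
to the root of `l`. -/
theorem IsFunctionalForest.leadsTo_insert_iff (hF : IsFunctionalForest F) (hi : IsSink F i)
    (hl : ¬ LeadsTo F l i) (hj : j ≠ i) :
    LeadsTo (insert (i, l) F) v j ↔ LeadsTo F v j ∨ (LeadsTo F v i ∧ LeadsTo F l j) := by
  have hF' := hF.insert_arc hi hl
  constructor
  · intro h
    obtain ⟨s, hs⟩ := hF.2 l
    have hsi : s ≠ i := fun e => hl (e ▸ hs)
    obtain ⟨r, hr⟩ := hF.2 v
    by_cases e : r = i
    · subst e
      rw [hF'.1.leadsTo_unique h (hr.insert_trans hs hsi)]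
      exact Or.inr ⟨hr, hs⟩
    · rw [hF'.1.leadsTo_unique h (hr.insert_arc e)]
      exact Or.inl hr
  · rintro (h | ⟨h1, h2⟩)
    · exact h.insert_arc hj
    · exact h1.insert_trans h2 hj

theorem IsFunctional.isSink_erase (hF : IsFunctional F) (h : (i, l) ∈ F) :
    IsSink (F.erase (i, l)) i := by
  intro b hb
  obtain ⟨h1, h2⟩ := Finset.mem_erase.1 hb
  exact h1 (by rw [hF i b l h2 h])

theorem IsFunctionalForest.erase (hF : IsFunctionalForest F) (h : (i, l) ∈ F) :
    IsFunctionalForest (F.erase (i, l)) := by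
  refine ⟨fun v a b ha hb => hF.1 v a b (Finset.mem_of_mem_erase ha) (Finset.mem_of_mem_erase hb),
    fun v => ?_⟩
  obtain ⟨r, h1, h2⟩ := hF.2 v
  induction h1 using Relation.ReflTransGen.head_induction_on with
  | refl => exact ⟨r, IsSink.leadsTo fun b hb => h2 b (Finset.mem_of_mem_erase hb)⟩
  | @head x y hxy _ ih =>
    -- Without its arc, `i` is a sink, so a walk that meets `i` stops there.
    by_cases e : x = i
    · exact ⟨i, e ▸ (hF.1.isSink_erase h).leadsTo⟩
    · obtain ⟨s, hs⟩ := ih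
      exact ⟨s, .head (Finset.mem_erase.2 ⟨fun h => e (congrArg Prod.fst h), hxy⟩) hs.1, hs.2⟩

/-- Otherwise `i` would lie on a cycle of `F`. Arcs being determined by their tails, no walk could
leave that cycle, and `i` would reach no sink. -/
theorem IsFunctionalForest.not_leadsTo_erase (hF : IsFunctionalForest F) (h : (i, l) ∈ F) :
    ¬ LeadsTo (F.erase (i, l)) l i := by
  rintro ⟨hli, -⟩
  have hli : Relation.ReflTransGen (fun a b => (a, b) ∈ F) l i :=
    Relation.ReflTransGen.mono (fun _ _ => Finset.mem_of_mem_erase) _ _ hli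
  obtain ⟨r, hr, hs⟩ := hF.2 i
  have key : Relation.ReflTransGen (fun a b => (a, b) ∈ F) r i := by
    clear hs
    induction hr with
    | refl => exact .refl
    | @tail x y _ hxy ih =>
      rcases ih.cases_head with rfl | ⟨c, hc, h3⟩
      · rwa [hF.1 _ _ _ hxy h]
      · rwa [hF.1 _ _ _ hxy hc]
  have hri : r = i := (hs.leadsTo_iff (r := i)).1 ⟨key, by
    rcases key.cases_head with e | ⟨c, hc, _⟩
    · exact e ▸ hs
    · exact absurd hc (hs c)⟩
  exact hs l (hri ▸ h)

end Reachability

/-! ### Weighted sums over forests and the recurrence for `Q` -/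

section Sums

/-- The arc sets of the forests with `k` arcs in the complete digraph. -/
noncomputable def forestArcSets (V : Type*) [Fintype V] [DecidableEq V] (k : ℕ) : Finset (Finset (V × V)) :=
  open scoped Classical in (Finset.univ.powersetCard k).filter IsFunctionalForest

variable {V : Type*} [Fintype V] [DecidableEq V] {F : Finset (V × V)} {k : ℕ}

theorem mem_forestArcSets : F ∈ forestArcSets V k ↔ F.card = k ∧ IsFunctionalForest F := by
  simp [forestArcSets, Finset.mem_powersetCard]

theorem forestArcSets_zero : forestArcSets V 0 = {∅} := by
  ext F
  rw [mem_forestArcSets, Finset.card_eq_zero, Finset.mem_singleton]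
  exact ⟨fun h => h.1, fun h => ⟨h, h ▸ isFunctionalForest_empty⟩⟩

open scoped Classical in
/-- Forests in which `i` is not a root arise from forests with root `i` by adding an arc from `i`
to another tree. -/
theorem sum_forestArcSets_succ (k : ℕ) (i : V) (f : Finset (V × V) → ℝ) :
    ∑ F ∈ (forestArcSets V (k + 1)).filter (fun F => ¬ IsSink F i), f F =
      ∑ G ∈ (forestArcSets V k).filter (fun G => IsSink G i),
        ∑ l ∈ Finset.univ.filter (fun l => ¬ LeadsTo G l i), f (insert (i, l) G) := by
  rw [Finset.sum_sigma']
  symm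
  refine Finset.sum_bij (fun x _ => insert (i, x.2) x.1) ?_ ?_ ?_ ?_
  · rintro ⟨G, l⟩ h
    simp only [Finset.mem_sigma, Finset.mem_filter, mem_forestArcSets, Finset.mem_univ,
      true_and] at h ⊢
    obtain ⟨⟨⟨hc, hG⟩, hi⟩, hl⟩ := h
    exact ⟨⟨by rw [Finset.card_insert_of_notMem (hi l), hc], hG.insert_arc hi hl⟩, not_isSink_insert⟩
  · rintro ⟨G, l⟩ h ⟨G', l'⟩ h' e
    simp only [Finset.mem_sigma, Finset.mem_filter, mem_forestArcSets, Finset.mem_univ,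
      true_and] at h h' e
    have hl : l = l' := by
      have h1 : (i, l) ∈ insert (i, l') G' := e ▸ Finset.mem_insert_self _ _
      rcases mem_insert_arc.1 h1 with ⟨_, h2⟩ | h2
      · exact h2
      · exact absurd h2 (h'.1.2 l)
    subst hl
    have hG : G = G' := by
      rw [← Finset.erase_insert (h.1.2 l), e, Finset.erase_insert (h'.1.2 l)]
    rw [hG]
  · intro F h
    simp only [Finset.mem_filter, mem_forestArcSets] at h
    obtain ⟨⟨hc, hF⟩, hi⟩ := h
    obtain ⟨l, hl⟩ : ∃ l, (i, l) ∈ F := by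
      by_contra hn
      exact hi fun b hb => hn ⟨b, hb⟩
    refine ⟨⟨F.erase (i, l), l⟩, ?_, Finset.insert_erase hl⟩
    simp only [Finset.mem_sigma, Finset.mem_filter, mem_forestArcSets, Finset.mem_univ, true_and]
    exact ⟨⟨⟨by rw [Finset.card_erase_of_mem hl, hc]; rfl, hF.erase hl⟩, hF.1.isSink_erase hl⟩,
      hF.not_leadsTo_erase hl⟩
  · intros; rfl

namespace WeightedDigraph

variable (Γ : WeightedDigraph V)

/-- Allows all sums to run over the forests of the complete digraph, where arcs can be added freely.
-/
theorem subgraphWeight_eq_zero (h : ¬ F ⊆ Γ.arcs) : Γ.subgraphWeight F = 0 := by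
  obtain ⟨e, he, hn⟩ := Finset.not_subset.1 h
  refine Finset.prod_eq_zero he (le_antisymm ?_ (Γ.nonneg _ _))
  simpa [arcs] using hn

theorem subgraphWeight_insert {i : V} (hi : IsSink F i) (l : V) :
    Γ.subgraphWeight (insert (i, l) F) = Γ.W i l * Γ.subgraphWeight F := by
  rw [subgraphWeight, Finset.prod_insert (hi l), subgraphWeight]

theorem mem_inForests : F ∈ Γ.inForests k ↔ F ∈ forestArcSets V k ∧ F ⊆ Γ.arcs := by
  simp only [inForests, Finset.mem_filter, Finset.mem_powersetCard, mem_forestArcSets,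
    isConvergingForest_iff]
  tauto

theorem sigma_eq (k : ℕ) : Γ.sigma k = ∑ F ∈ forestArcSets V k, Γ.subgraphWeight F :=
  Finset.sum_subset (fun _ hF => (Γ.mem_inForests.1 hF).1)
    fun _ hF hn => Γ.subgraphWeight_eq_zero fun h => hn (Γ.mem_inForests.2 ⟨hF, h⟩)

open scoped Classical in
theorem Q_apply (k : ℕ) (i j : V) :
    Γ.Q k i j = ∑ F ∈ (forestArcSets V k).filter (fun F => LeadsTo F i j), Γ.subgraphWeight F := by
  have hc : ∀ F ∈ forestArcSets V k,
      (ConvergesTo F ((underlyingGraph F).connectedComponentMk i) j ↔ LeadsTo F i j) :=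
    fun F hF => (mem_forestArcSets.1 hF).2.1.convergesTo_iff
  refine Finset.sum_subset (fun F hF => ?_) fun F hF hn => Γ.subgraphWeight_eq_zero fun h => hn ?_
  · obtain ⟨h1, h2⟩ := Finset.mem_filter.1 hF
    have h3 := (Γ.mem_inForests.1 h1).1
    exact Finset.mem_filter.2 ⟨h3, (hc F h3).1 h2⟩
  · obtain ⟨h1, h2⟩ := Finset.mem_filter.1 hF
    exact Finset.mem_filter.2 ⟨Γ.mem_inForests.2 ⟨h1, h⟩, (hc F h1).2 h2⟩

theorem sigma_zero : Γ.sigma 0 = 1 := by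
  rw [sigma_eq, forestArcSets_zero, Finset.sum_singleton, subgraphWeight, Finset.prod_empty]

theorem Q_zero : Γ.Q 0 = 1 := by
  ext i j
  have h : LeadsTo (∅ : Finset (V × V)) i j ↔ i = j :=
    IsSink.leadsTo_iff fun _ => Finset.notMem_empty _
  rw [Q_apply, forestArcSets_zero, Finset.sum_filter, Finset.sum_singleton, Matrix.one_apply]
  simp [h, subgraphWeight]

open scoped Classical in
theorem sum_not_isSink (k : ℕ) (i : V) (f : Finset (V × V) → ℝ) :
    ∑ F ∈ forestArcSets V (k + 1), (if IsSink F i then 0 else Γ.subgraphWeight F * f F) =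
      ∑ G ∈ forestArcSets V k, if IsSink G i then
        Γ.subgraphWeight G *
          ∑ l, Γ.W i l * (if LeadsTo G l i then 0 else f (insert (i, l) G)) else 0 := by
  have h := sum_forestArcSets_succ k i fun F => Γ.subgraphWeight F * f F
  rw [Finset.sum_filter, Finset.sum_filter] at h
  simp only [ite_not] at h
  rw [h]
  refine Finset.sum_congr rfl fun G _ => ?_
  split_ifs with hi
  · rw [Finset.sum_filter, Finset.mul_sum]
    refine Finset.sum_congr rfl fun l _ => ?_
    rw [ite_not]
    split_ifs
    · ring
    · rw [Γ.subgraphWeight_insert hi]; ring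
  · rfl

open scoped Classical in
theorem Q_apply_eq_sum (k : ℕ) (i j : V) :
    Γ.Q k i j =
      ∑ F ∈ forestArcSets V k, Γ.subgraphWeight F * (if LeadsTo F i j then 1 else 0) := by
  rw [Q_apply, Finset.sum_filter]
  simp only [mul_ite, mul_one, mul_zero]

open scoped Classical in
theorem sum_weight_mul_Q (k : ℕ) (i j : V) :
    ∑ l, Γ.W i l * Γ.Q k l j = ∑ F ∈ forestArcSets V k, Γ.subgraphWeight F *
      ∑ l, Γ.W i l * (if LeadsTo F l j then 1 else 0) := by
  simp only [Q_apply_eq_sum, Finset.mul_sum]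
  rw [Finset.sum_comm]
  exact Finset.sum_congr rfl fun F _ => Finset.sum_congr rfl fun l _ => by ring

open scoped Classical in
theorem sigma_succ_sub_Q (k : ℕ) (i : V) :
    Γ.sigma (k + 1) - Γ.Q (k + 1) i i =
      ∑ l, Γ.W i l * Γ.Q k i i - ∑ l, Γ.W i l * Γ.Q k l i := by
  have h := Γ.sum_not_isSink k i fun _ => 1
  have hs : ∀ F : Finset (V × V), LeadsTo F i i ↔ IsSink F i :=
    fun F => ⟨fun h => h.2, fun h => h.leadsTo⟩
  rw [sum_weight_mul_Q, sigma_eq, Q_apply_eq_sum, ← Finset.sum_sub_distrib, ← Finset.sum_mul,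
    Q_apply_eq_sum, Finset.mul_sum, ← Finset.sum_sub_distrib]
  simp only [hs]
  convert h using 1
  · refine Finset.sum_congr rfl fun F _ => ?_
    split_ifs <;> ring
  · refine Finset.sum_congr rfl fun G _ => ?_
    split_ifs with hi
    · rw [mul_one, mul_comm, ← mul_sub, ← Finset.sum_sub_distrib]
      congr 1
      refine Finset.sum_congr rfl fun l _ => ?_
      split_ifs <;> ring
    -- Forests in which `i` is not a sink contribute nothing to either sum.
    · have : ∀ l, ¬ LeadsTo G l i := fun l hl => hi hl.2
      simp [this]

open scoped Classical in
theorem Q_succ_of_ne (k : ℕ) {i j : V} (hij : i ≠ j) :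
    Γ.Q (k + 1) i j = ∑ G ∈ forestArcSets V k, if IsSink G i then
      Γ.subgraphWeight G * ∑ l, Γ.W i l * (if LeadsTo G l j then 1 else 0) else 0 := by
  have h := Γ.sum_not_isSink k i fun F => if LeadsTo F i j then 1 else 0
  rw [Q_apply_eq_sum]
  convert h using 1
  · refine Finset.sum_congr rfl fun F _ => ?_
    split_ifs with h1 h2
    · exact absurd (h2.leadsTo_iff.1 h1) hij
    all_goals ring
  · refine Finset.sum_congr rfl fun G hG => ?_
    have hG := (mem_forestArcSets.1 hG).2
    split_ifs with hi
    · congr 1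
      refine Finset.sum_congr rfl fun l _ => ?_
      congr 1
      by_cases hl : LeadsTo G l i
      · rw [if_pos hl, if_neg fun h => hij (hG.1.leadsTo_unique hl h)]
      · rw [if_neg hl]
        refine if_congr ?_ rfl rfl
        rw [hG.leadsTo_insert_iff hi hl hij.symm, hi.leadsTo_iff]
        simp [hij, hi.leadsTo]
    · rfl

open scoped Classical in
/-- Exchanging the arc from `i` in a forest with a further arc from `i`. -/
theorem sum_weight_mul_Q_of_ne (k : ℕ) {i j : V} (hij : i ≠ j) :
    ∑ l, Γ.W i l * Γ.Q k i j = ∑ F ∈ forestArcSets V k, if IsSink F i then 0 else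
      Γ.subgraphWeight F * ∑ l, Γ.W i l * (if LeadsTo F l j then 1 else 0) := by
  cases k with
  | zero =>
    have : IsSink (∅ : Finset (V × V)) i := fun _ => Finset.notMem_empty _
    simp [forestArcSets_zero, this, Q_zero, hij]
  | succ k =>
    rw [Γ.sum_not_isSink k i, ← Finset.sum_mul, Γ.Q_succ_of_ne k hij, Finset.mul_sum]
    refine Finset.sum_congr rfl fun G hG => ?_
    have hG := (mem_forestArcSets.1 hG).2
    split_ifs with hi
    · set x : V → ℝ := fun l => if LeadsTo G l j then 1 else 0 with hx
      set y : V → ℝ := fun l => if LeadsTo G l i then 1 else 0 with hy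
      -- Here `l` is the head of the forest's arc from `i`, and `m` that of the further arc. In the
      -- enlarged forest `m` leads to `j` either already in `G`, or through `i` and then `l`.
      have key : ∀ l, (if LeadsTo G l i then 0 else
          ∑ m, Γ.W i m * (if LeadsTo (insert (i, l) G) m j then 1 else 0)) =
          (1 - y l) * ∑ m, Γ.W i m * x m + x l * ∑ m, Γ.W i m * y m := by
        intro l
        by_cases hl : LeadsTo G l i
        · have : ¬ LeadsTo G l j := fun h => hij (hG.1.leadsTo_unique hl h)
          simp [hx, hy, hl, this]
        · rw [if_neg hl, Finset.mul_sum, Finset.mul_sum, ← Finset.sum_add_distrib]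
          refine Finset.sum_congr rfl fun m _ => ?_
          have hm : ¬ (LeadsTo G m i ∧ LeadsTo G m j) := fun h =>
            hij (hG.1.leadsTo_unique h.1 h.2)
          simp only [hx, hy, hG.leadsTo_insert_iff hi hl hij.symm, if_neg hl]
          by_cases h1 : LeadsTo G m i <;> by_cases h2 : LeadsTo G m j <;>
            by_cases h3 : LeadsTo G l j <;> simp_all
      simp only [key]
      -- With A, X, Y the `W i`-weighted sums of 1, `x`, `y`, this is (A − Y)X + XY = AX.
      have e1 : ∑ l, Γ.W i l * ((1 - y l) * ∑ m, Γ.W i m * x m + x l * ∑ m, Γ.W i m * y m) =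
          (∑ l, Γ.W i l) * ∑ m, Γ.W i m * x m := by
        simp only [mul_add, mul_sub, sub_mul, one_mul, Finset.sum_add_distrib,
          Finset.sum_sub_distrib, ← mul_assoc, ← Finset.sum_mul]
        ring
      rw [e1]
      ring
    · rw [mul_zero]

theorem laplacian_mul_apply (A : Matrix V V ℝ) (i j : V) :
    (Γ.laplacian * A) i j = ∑ l, Γ.W i l * A i j - ∑ l, Γ.W i l * A l j := by
  rw [Matrix.mul_apply, ← Finset.add_sum_erase _ _ (Finset.mem_univ i),
    ← Finset.add_sum_erase _ (fun l => Γ.W i l * A i j) (Finset.mem_univ i),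
    ← Finset.add_sum_erase _ (fun l => Γ.W i l * A l j) (Finset.mem_univ i)]
  have h : ∑ l ∈ Finset.univ.erase i, Γ.laplacian i l * A l j =
      -∑ l ∈ Finset.univ.erase i, Γ.W i l * A l j := by
    rw [← Finset.sum_neg_distrib]
    refine Finset.sum_congr rfl fun l hl => ?_
    simp [laplacian, (Finset.ne_of_mem_erase hl).symm]
  rw [h, laplacian, Matrix.of_apply, if_pos rfl, Finset.sum_mul, Γ.loopless]
  ring

/-- Off the diagonal, split the forests in ∑ W_il (Q_k)_lj: those with `i` a root give (Q_{k+1})_ij,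
the others cancel the outdegree term of `L`. -/
theorem Q_succ (k : ℕ) : Γ.Q (k + 1) = Γ.sigma (k + 1) • 1 - Γ.laplacian * Γ.Q k := by
  classical
  ext i j
  rw [Matrix.sub_apply, Matrix.smul_apply, laplacian_mul_apply, smul_eq_mul]
  by_cases hij : i = j
  · subst hij
    rw [Matrix.one_apply_eq, ← Γ.sigma_succ_sub_Q]
    ring
  · rw [Matrix.one_apply_ne hij, Γ.sum_weight_mul_Q_of_ne k hij, Γ.Q_succ_of_ne k hij,
      sum_weight_mul_Q, ← Finset.sum_sub_distrib, mul_zero, zero_sub, ← Finset.sum_neg_distrib]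
    refine Finset.sum_congr rfl fun F _ => ?_
    split_ifs <;> ring

end WeightedDigraph

end Sums

/-! ### The coefficients α_k as an inverse power series -/

section InverseSeries

open PowerSeries

theorem coeff_inv_one_add (k : ℕ) (S : PowerSeries ℝ) (hS : constantCoeff S = 0) :
    coeff k (1 + S)⁻¹ = coeff k (∑ n ∈ Finset.range (k + 1), (-S) ^ n) := by
  have h1 : (1 + S) * (1 + S)⁻¹ = 1 := PowerSeries.mul_inv_cancel _ (by simp [hS])
  have h2 : (1 - -S) * ∑ n ∈ Finset.range (k + 1), (-S) ^ n = 1 - (-S) ^ (k + 1) :=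
    mul_neg_geom_sum _ _
  have h3 : (1 + S)⁻¹ - ∑ n ∈ Finset.range (k + 1), (-S) ^ n = (-S) ^ (k + 1) * (1 + S)⁻¹ := by
    linear_combination (∑ n ∈ Finset.range (k + 1), (-S) ^ n) * h1 - (1 + S)⁻¹ * h2
  have h4 : (X : PowerSeries ℝ) ^ (k + 1) ∣
      (1 + S)⁻¹ - ∑ n ∈ Finset.range (k + 1), (-S) ^ n := by
    rw [h3]
    exact (pow_dvd_pow_of_dvd (X_dvd_iff.2 (by simp [hS])) _).mul_right _
  rw [← sub_eq_zero, ← map_sub]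
  exact X_pow_dvd_iff.1 h4 k (Nat.lt_succ_self k)

/-- Terms of degree above `k` cannot affect the `k`-th coefficient; truncation leaves a finite sum,
to which the multinomial theorem applies. -/
theorem coeff_pow_mk (σ : ℕ → ℝ) (k n : ℕ) :
    coeff k ((mk fun i => if i = 0 then 0 else σ i) ^ n) =
      coeff k ((∑ i : Fin k, monomial ((i : ℕ) + 1) (σ (i + 1))) ^ n) := by
  have h : (X : PowerSeries ℝ) ^ (k + 1) ∣ (mk fun i => if i = 0 then 0 else σ i) -
      ∑ i : Fin k, monomial ((i : ℕ) + 1) (σ (i + 1)) := by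
    rw [X_pow_dvd_iff]
    intro m hm
    rw [map_sub, map_sum, coeff_mk, sub_eq_zero]
    simp only [coeff_monomial]
    cases m with
    | zero => simp
    | succ m =>
      rw [Finset.sum_eq_single ⟨m, by omega⟩]
      · simp
      · intro b _ hb
        rw [if_neg]
        intro e
        exact hb (Fin.ext (by simp only; omega))
      · simp
  rw [← sub_eq_zero, ← map_sub]
  exact X_pow_dvd_iff.1 (h.trans (sub_dvd_pow_sub_pow _ _ n)) k (Nat.lt_succ_self k)

theorem coeff_pow_sum_monomial (σ : ℕ → ℝ) (k n : ℕ) :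
    coeff k ((∑ i : Fin k, monomial ((i : ℕ) + 1) (σ (i + 1))) ^ n) =
      ∑ p ∈ (partitionTuples k).filter (fun p => ∑ i, p i = n),
        (n ! : ℝ) / ((∏ i, (p i)! : ℕ) : ℝ) * ∏ i : Fin k, σ (i + 1) ^ p i := by
  rw [Finset.sum_pow_eq_sum_piAntidiag, map_sum]
  have hprod : ∀ p : Fin k → ℕ, ∏ i : Fin k, monomial ((i : ℕ) + 1) (σ (i + 1)) ^ p i =
      monomial (∑ i : Fin k, ((i : ℕ) + 1) * p i) (∏ i : Fin k, σ (i + 1) ^ p i) := by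
    intro p
    simp only [monomial_pow, prod_monomial, mul_comm]
  have hset : (partitionTuples k).filter (fun p => ∑ i, p i = n) =
      (Finset.univ.piAntidiag n).filter (fun p => ∑ i : Fin k, ((i : ℕ) + 1) * p i = k) := by
    ext p
    simp only [Finset.mem_filter, mem_partitionTuples, Finset.mem_piAntidiag, Finset.mem_univ,
      implies_true, and_true]
    tauto
  rw [hset, Finset.sum_filter]
  refine Finset.sum_congr rfl fun p hp => ?_
  rw [hprod, ← map_natCast (C (R := ℝ)), coeff_C_mul, coeff_monomial]
  have hp : ∑ i, p i = n := (Finset.mem_piAntidiag.1 hp).1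
  have hm : ((Nat.multinomial Finset.univ p : ℕ) : ℝ) = (n ! : ℝ) / ((∏ i, (p i)! : ℕ) : ℝ) := by
    rw [eq_div_iff (Nat.cast_ne_zero.2 (Finset.prod_ne_zero_iff.2 fun i _ =>
      Nat.factorial_ne_zero _)), ← Nat.cast_mul, mul_comm, Nat.multinomial_spec, hp]
  rw [hm]
  by_cases e : ∑ i : Fin k, ((i : ℕ) + 1) * p i = k
  · rw [if_pos e, if_pos e.symm]
  · rw [if_neg e, if_neg (Ne.symm e), mul_zero]

namespace WeightedDigraph

variable {V : Type*} [Fintype V] [DecidableEq V] (Γ : WeightedDigraph V)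

theorem alpha_zero : Γ.alpha 0 = 1 := if_pos rfl

theorem sum_le_of_mem_partitionTuples {k : ℕ} {p : Fin k → ℕ} (hp : p ∈ partitionTuples k) :
    ∑ i, p i ≤ k := by
  rw [mem_partitionTuples] at hp
  calc ∑ i, p i ≤ ∑ i : Fin k, ((i : ℕ) + 1) * p i :=
        Finset.sum_le_sum fun i _ => Nat.le_mul_of_pos_left _ (Nat.succ_pos _)
    _ = k := hp

theorem alpha_eq_coeff (k : ℕ) : Γ.alpha k = coeff k (PowerSeries.mk Γ.sigma)⁻¹ := by
  have hS : PowerSeries.mk Γ.sigma = 1 + PowerSeries.mk fun i => if i = 0 then 0 else Γ.sigma i := by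
    ext n
    rw [map_add, coeff_mk, coeff_mk, coeff_one]
    split_ifs with h
    · rw [h, sigma_zero, add_zero]
    · rw [zero_add]
  rw [hS, coeff_inv_one_add _ _ (by simp [← coeff_zero_eq_constantCoeff_apply]), map_sum]
  by_cases hk : k = 0
  · subst hk
    simp [alpha_zero]
  -- Tuples with ∑ p_i = n make up the n-th term of the geometric series.
  rw [alpha, if_neg hk, ← Finset.sum_fiberwise_of_maps_to (s := partitionTuples k)
    (t := Finset.range (k + 1)) (g := fun p => ∑ i, p i)
    fun p hp => Finset.mem_range.2 (Nat.lt_succ_of_le (sum_le_of_mem_partitionTuples hp))]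
  refine Finset.sum_congr rfl fun n _ => ?_
  have hneg : ∀ S : PowerSeries ℝ, (-S) ^ n = C ((-1 : ℝ) ^ n) * S ^ n := by
    intro S
    rw [neg_pow, map_pow, map_neg, map_one]
  rw [hneg, coeff_C_mul, coeff_pow_mk, coeff_pow_sum_monomial, Finset.mul_sum]
  refine Finset.sum_congr rfl fun p hp => ?_
  rw [(Finset.mem_filter.1 hp).2, mul_assoc]

theorem sum_alpha_mul_sigma (m : ℕ) :
    ∑ k ∈ Finset.range (m + 2), Γ.alpha k * Γ.sigma (m + 1 - k) = 0 := by
  have h : (PowerSeries.mk Γ.sigma)⁻¹ * PowerSeries.mk Γ.sigma = 1 :=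
    PowerSeries.inv_mul_cancel _ (by
      rw [← coeff_zero_eq_constantCoeff_apply, coeff_mk, sigma_zero]; exact one_ne_zero)
  have h2 := congrArg (coeff (m + 1)) h
  rw [coeff_mul, Finset.Nat.sum_antidiagonal_eq_sum_range_succ_mk, coeff_one,
    if_neg (Nat.succ_ne_zero m)] at h2
  simpa only [← alpha_eq_coeff, coeff_mk] using h2

end WeightedDigraph

end InverseSeries

theorem proposition8 {V : Type*} [Fintype V] [DecidableEq V] (Γ : WeightedDigraph V) (m : ℕ) :
    (-Γ.laplacian) ^ m = ∑ k ∈ Finset.range (m + 1), Γ.alpha k • Γ.Q (m - k) := by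
  induction m with
  | zero => simp [Γ.alpha_zero, Γ.Q_zero]
  | succ m ih =>
    have h0 := Γ.sum_alpha_mul_sigma m
    -- As σ_0 = 1, this isolates α_{m+1}, which will cancel the multiples of the identity produced
    -- by `Q_succ`.
    rw [Finset.sum_range_succ, Nat.sub_self, Γ.sigma_zero, mul_one] at h0
    have h1 : ∑ k ∈ Finset.range (m + 1), Γ.alpha k • Γ.Q (m + 1 - k) =
        ∑ k ∈ Finset.range (m + 1), ((Γ.alpha k * Γ.sigma (m + 1 - k)) • (1 : Matrix V V ℝ) +
          -Γ.laplacian * (Γ.alpha k • Γ.Q (m - k))) := by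
      refine Finset.sum_congr rfl fun k hk => ?_
      have hk : k ≤ m := Nat.lt_succ_iff.1 (Finset.mem_range.1 hk)
      rw [Nat.succ_sub hk, Nat.succ_eq_add_one, Γ.Q_succ, smul_sub, smul_smul, Matrix.mul_smul,
        neg_mul, smul_neg, sub_eq_add_neg]
    rw [Finset.sum_range_succ, h1, Nat.sub_self, Γ.Q_zero, Finset.sum_add_distrib,
      ← Finset.mul_sum, ← ih, ← Finset.sum_smul, add_right_comm, ← add_smul, h0, zero_smul,
      zero_add, pow_succ']
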